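/- Let $q$ be a prime power and let $n\ge 2$, $1\le k\le 2n-1$ and $s\ge 1$ be integers with $\gcd(s,2n)=1$. Write $N(x)=x^{1+q+\cdots+q^{2n-1}}$ for the norm from $\mathbb F_{q^{2n}}$ to $\mathbb F_q$, and let $\gamma\in\mathbb F_{q^{2n}}$ be such that $N(\gamma)$ is a non-square in $\mathbb F_q$. Put $$\mathcal D_{k,s}(\gamma)=\Big\{aX+\sum_{i=1}^{k-1}c_iX^{q^{is}}+\gamma bX^{q^{ks}} : a,b\in\mathbb F_{q^n},\ c_1,\dots,c_{k-1}\in\mathbb F_{q^{2n}}\Big\}.$$ For an integer $t\ge 1$ with $\gcd(t,2n)=1$, for $1\le l\le 2n$, for an integer $h\ge 0$ and for $\eta\in\mathbb F_{q^{2n}}$ with $N(\eta)\ne(-1)^{2nk}=1$, let $$\mathcal G_{l,t}=\Big\{\sum_{i=0}^{l-1}a_iX^{q^{it}} : a_i\in\mathbb F_{q^{2n}}\Big\},\qquad \mathcal H_{k,t}(\eta,h)=\Big\{\sum_{i=0}^{k-1}a_iX^{q^{it}}+\eta a_0^{q^h}X^{q^{kt}} : a_i\in\mathbb F_{q^{2n}}\Big\}$$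 be the generalized Gabidulin codes and the generalized twisted Gabidulin codes. Each of these linearized polynomials is regarded as the $\mathbb F_q$-linear map it induces on $\mathbb F_{q^{2n}}$, and hence, through a fixed $\mathbb F_q$-basis of $\mathbb F_{q^{2n}}$, as a matrix in $\mathbb F_q^{2n\times 2n}$. Two codes $\mathcal C_1,\mathcal C_2\subseteq\mathbb F_q^{2n\times 2n}$ are called equivalent if $\mathcal C_2=\{AM^\rho B+C : M\in\mathcal C_1\}$ for some $A,B\in\mathrm{GL}_{2n}(\mathbb F_q)$, $C\in\mathbb F_q^{2n\times 2n}$ and $\rho\in\mathrm{Aut}(\mathbb F_q)$, where $\rho$ acts on the entries of $M$. Then: 1. $\mathcal D_{k,s}(\gamma)$ is not equivalent to any generalized Gabidulin code $\mathcal G_{l,t}$. 2. If $k\ne n$ or $h\ne n$, then $\mathcal D_{k,s}(\gamma)$ is not equivalent to any generalized twisted Gabidulin code $\mathcal H_{k,t}(\eta,h)$ with $\eta\ne 0$. -/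

import Mathlib

open scoped BigOperators

namespace RankMetric

noncomputable section

/-- Equivalence of rank-metric codes in `K^{m × n}`:
`C₂ = {A M^ρ B + C : M ∈ C₁}` with `A`, `B` invertible, `C` arbitrary, `ρ ∈ Aut(K)` acting on
the entries of `M`. -/
def Equivalent {K : Type*} [Field K] {m n : ℕ}
    (C₁ C₂ : Set (Matrix (Fin m) (Fin n) K)) : Prop :=
  ∃ (A : GL (Fin m) K) (B : GL (Fin n) K) (C : Matrix (Fin m) (Fin n) K) (ρ : K ≃+* K),
    C₂ = {N | ∃ M ∈ C₁,
      N = (A : Matrix (Fin m) (Fin m) K) * M.map ρ * (B : Matrix (Fin n) (Fin n) K) + C}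

section LinearizedPolynomials

variable (K : Type*) {L : Type*} [Field K] [Fintype K] [Field L] [Algebra K L]

/-- The map `x ↦ c x^{q^j}` on `L` given by the linearized monomial `c X^{q^j}`, `q = |K|`,
as a `K`-linear map. -/
def qMonomial (c : L) (j : ℕ) : L →ₗ[K] L :=
  c • ((FiniteField.frobeniusAlgHom K L) ^ j).toLinearMap

theorem qMonomial_apply (c : L) (j : ℕ) (x : L) :
    qMonomial K c j x = c * x ^ (Fintype.card K ^ j) := by
  have h : ∀ j : ℕ, ((FiniteField.frobeniusAlgHom K L) ^ j) x = x ^ (Fintype.card K ^ j) := by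
    intro j
    induction j with
    | zero => simp
    | succ j ih => rw [pow_succ', AlgHom.mul_apply, ih]; simp [← pow_mul, pow_succ]
  simp [qMonomial, h]

/-- The subfield `F_{q^n}` of `L`, as the set of roots of `X^{q^n} - X`; if `[L : K] = 2n`,
this is the unique subfield of `L` with `q^n` elements. -/
def subfieldFq (L : Type*) [Field L] (n : ℕ) : Set L :=
  {a | a ^ (Fintype.card K ^ n) = a}

/-- The generalized Gabidulin code `G_{k,s}`:
all `a_0 X + a_1 X^{q^s} + ⋯ + a_{k-1} X^{q^{s(k-1)}}` with `a_i ∈ L`. -/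
def gabidulin (L : Type*) [Field L] [Algebra K L] (k s : ℕ) : Set (L →ₗ[K] L) :=
  {f | ∃ a : ℕ → L, f = ∑ i ∈ Finset.range k, qMonomial K (a i) (i * s)}

/-- The generalized twisted Gabidulin code `H_{k,s}(η, h)`: all
`a_0 X + a_1 X^{q^s} + ⋯ + a_{k-1} X^{q^{s(k-1)}} + η a_0^{q^h} X^{q^{sk}}` with `a_i ∈ L`. -/
def twistedGabidulin (k s : ℕ) (η : L) (h : ℕ) : Set (L →ₗ[K] L) :=
  {f | ∃ a : ℕ → L, f = ∑ i ∈ Finset.range k, qMonomial K (a i) (i * s)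
      + qMonomial K (η * a 0 ^ (Fintype.card K ^ h)) (k * s)}

/-- The code `D_{k,s}(γ)`: all
`a X + c_1 X^{q^s} + ⋯ + c_{k-1} X^{q^{(k-1)s}} + γ b X^{q^{ks}}` with `c_i ∈ L` and
`a, b ∈ F_{q^n}`. -/
def codeD (n k s : ℕ) (γ : L) : Set (L →ₗ[K] L) :=
  {f | ∃ a ∈ subfieldFq K L n, ∃ b ∈ subfieldFq K L n, ∃ c : ℕ → L,
    f = qMonomial K a 0 + ∑ i ∈ Finset.Ico 1 k, qMonomial K (c i) (i * s)
      + qMonomial K (γ * b) (k * s)}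

end LinearizedPolynomials

/-- The rank-metric code in `K^{m × m}` that a set of `K`-linear maps of `L` defines through a
`K`-basis of `L`. -/
def matrixCode {K L : Type*} [Field K] [Field L] [Algebra K L] {m : ℕ}
    (β : Module.Basis (Fin m) K L) (S : Set (L →ₗ[K] L)) : Set (Matrix (Fin m) (Fin m) K) :=
  {M | ∃ f ∈ S, M = LinearMap.toMatrix β β f}

end

end RankMetric

/-! Equivalent additive codes have left and right idealizers of equal size, and these sizes separate
the codes. By Dedekind independence and a dimension count, the cyclic group `Gal(L/K)` is an
`L`-basis of `End_K(L)`, so every `K`-linear map is a skew polynomial in a generator `σ`. The codes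
`codeD` and `twistedGabidulin` are windows `1, σ, …, σ^k` with free inner coefficients and a
condition `W` on the two end coefficients. When `W` is transversal, the idealizers contain only
scalars (`galCoeff_eq_zero_of_mem_leftIdealizer`, `galCoeff_eq_zero_of_mem_rightIdealizer`), and `W`
tells which ones.

For `codeD` both idealizers are the subfield fixed by `frob ^ n`. The left idealizer of a Gabidulin
code contains all of `L`, which is too large. For a twisted code with `τ = frob ^ h`, the left
idealizer is the fixed field of `τ` and the right one that of `τ⁻¹ σ^k`; in the degenerate cases `τ
= 1` and `τ = σ^k` one idealizer again contains `L`. Equal sizes force `τ` and `τ⁻¹ σ^k` to have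
order 2, so both are the unique involution `frob ^ n`. Then `σ^k = 1`, impossible for `0 < k < 2n`.
-/

namespace RankMetric

/-! ### Linear maps as skew polynomials over the Galois group -/

section GaloisCoefficients

variable {K L : Type*} [Field K] [Field L] [Algebra K L] [FiniteDimensional K L] [IsGalois K L]

theorem linearIndependent_algEquiv_toLinearMap (K L : Type*) [Field K] [Field L] [Algebra K L] :
    LinearIndependent L (fun g : L ≃ₐ[K] L => g.toLinearMap) :=
  (linearIndependent_toLinearMap K L L).comp (fun g : L ≃ₐ[K] L => (g : L →ₐ[K] L))
    (fun _ _ h => AlgEquiv.ext fun x => DFunLike.congr_fun h x)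

theorem card_algEquiv_eq_finrank_linearMap (K L : Type*) [Field K] [Field L] [Algebra K L]
    [FiniteDimensional K L] [IsGalois K L] :
    Fintype.card (L ≃ₐ[K] L) = Module.finrank L (L →ₗ[K] L) := by
  rw [Module.finrank_linearMap_self, ← IsGalois.card_aut_eq_finrank, Nat.card_eq_fintype_card]

/-- The elements of the Galois group form an `L`-basis of `End_K(L)`. -/
noncomputable def galBasis (K L : Type*) [Field K] [Field L] [Algebra K L] [FiniteDimensional K L]
    [IsGalois K L] : Module.Basis (L ≃ₐ[K] L) L (L →ₗ[K] L) :=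
  basisOfLinearIndependentOfCardEqFinrank (linearIndependent_algEquiv_toLinearMap K L)
    (card_algEquiv_eq_finrank_linearMap K L)

theorem galBasis_apply (g : L ≃ₐ[K] L) : galBasis K L g = g.toLinearMap := by
  rw [galBasis, coe_basisOfLinearIndependentOfCardEqFinrank]

/-- The coefficient at `g` of a `K`-linear map of `L` in the basis `Gal(L/K)`. -/
noncomputable def galCoeff (f : L →ₗ[K] L) (g : L ≃ₐ[K] L) : L :=
  (galBasis K L).repr f g

theorem sum_galCoeff_smul (f : L →ₗ[K] L) : ∑ g, galCoeff f g • g.toLinearMap = f := by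
  simpa only [galBasis_apply, galCoeff] using (galBasis K L).sum_repr f

theorem galCoeff_ext {f f' : L →ₗ[K] L} (h : ∀ g, galCoeff f g = galCoeff f' g) : f = f' :=
  (galBasis K L).ext_elem h

theorem galCoeff_add (f f' : L →ₗ[K] L) (g : L ≃ₐ[K] L) :
    galCoeff (f + f') g = galCoeff f g + galCoeff f' g := by
  simp [galCoeff]

theorem galCoeff_sum {ι : Type*} (s : Finset ι) (f : ι → L →ₗ[K] L) (g : L ≃ₐ[K] L) :
    galCoeff (∑ i ∈ s, f i) g = ∑ i ∈ s, galCoeff (f i) g := by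
  simp [galCoeff]

open Classical in
theorem galCoeff_smul_toLinearMap (c : L) (g g' : L ≃ₐ[K] L) :
    galCoeff (c • g.toLinearMap) g' = if g = g' then c else 0 := by
  rw [galCoeff, ← galBasis_apply, map_smul, Module.Basis.repr_self]
  simp [Finsupp.single_apply]

/-- The multiplication rule of the skew group ring: moving `c` to the left past `g` turns it into `g
c`. -/
theorem galCoeff_mul_smul (f : L →ₗ[K] L) (c : L) (τ g : L ≃ₐ[K] L) :
    galCoeff (f * (c • τ.toLinearMap)) (g * τ) = galCoeff f g * g c := by
  classical
  have h : f * (c • τ.toLinearMap) = ∑ g, (galCoeff f g * g c) • (g * τ).toLinearMap := by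
    conv_lhs => rw [← sum_galCoeff_smul f]
    ext x
    simp [mul_assoc]
  rw [h, galCoeff_sum]
  simp [galCoeff_smul_toLinearMap]

theorem galCoeff_smul_mul (f : L →ₗ[K] L) (c : L) (τ g : L ≃ₐ[K] L) :
    galCoeff ((c • τ.toLinearMap) * f) (τ * g) = c * τ (galCoeff f g) := by
  classical
  have h : (c • τ.toLinearMap) * f = ∑ g, (c * τ (galCoeff f g)) • (τ * g).toLinearMap := by
    conv_lhs => rw [← sum_galCoeff_smul f]
    ext x
    simp [mul_assoc, Finset.mul_sum]
  rw [h, galCoeff_sum]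
  simp [galCoeff_smul_toLinearMap]

/-- The maps `∑_{i ≤ k} a_i σ^i` with `(a_0, a_k) ∈ W` (see `mem_windowCode_iff`), described by
their coefficients. -/
def windowCode (σ : L ≃ₐ[K] L) (k : ℕ) (W : Set (L × L)) : Set (L →ₗ[K] L) :=
  {f | (∀ g, (∀ i ≤ k, g ≠ σ ^ i) → galCoeff f g = 0) ∧ (galCoeff f 1, galCoeff f (σ ^ k)) ∈ W}

theorem pow_eq_pow_of_lt_orderOf {G : Type*} [Group G] {σ : G} {i j : ℕ}
    (hi : i < orderOf σ) (hj : j < orderOf σ) : σ ^ i = σ ^ j ↔ i = j :=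
  ⟨fun h => pow_injOn_Iio_orderOf hi hj h, fun h => h ▸ rfl⟩

theorem mem_windowCode_iff {σ : L ≃ₐ[K] L} {k : ℕ} (hkm : k < orderOf σ) {W : Set (L × L)}
    {f : L →ₗ[K] L} : f ∈ windowCode σ k W ↔
      ∃ a : ℕ → L, (a 0, a k) ∈ W ∧ f = ∑ i ∈ Finset.range (k + 1), a i • (σ ^ i).toLinearMap := by
  classical
  have key : ∀ (a : ℕ → L), ∀ j ≤ k,
      galCoeff (∑ i ∈ Finset.range (k + 1), a i • (σ ^ i).toLinearMap) (σ ^ j) = a j := by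
    intro a j hj
    rw [galCoeff_sum, Finset.sum_eq_single j]
    · simp [galCoeff_smul_toLinearMap]
    · intro i hi hij
      rw [galCoeff_smul_toLinearMap, if_neg]
      rw [Finset.mem_range] at hi
      rwa [pow_eq_pow_of_lt_orderOf (by omega) (by omega)]
    · intro h
      exact absurd (Finset.mem_range.2 (by omega)) h
  have key0 : ∀ (a : ℕ → L) (g : L ≃ₐ[K] L), (∀ i ≤ k, g ≠ σ ^ i) →
      galCoeff (∑ i ∈ Finset.range (k + 1), a i • (σ ^ i).toLinearMap) g = 0 := by
    intro a g hg
    rw [galCoeff_sum]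
    refine Finset.sum_eq_zero fun i hi => ?_
    rw [Finset.mem_range] at hi
    rw [galCoeff_smul_toLinearMap, if_neg (hg i (by omega)).symm]
  constructor
  · rintro ⟨h0, hW⟩
    refine ⟨fun i => galCoeff f (σ ^ i), by simpa using hW, galCoeff_ext fun g => ?_⟩
    by_cases hg : ∀ i ≤ k, g ≠ σ ^ i
    · rw [h0 g hg, key0 _ g hg]
    · push Not at hg
      obtain ⟨i, hi, rfl⟩ := hg
      rw [key _ i hi]
  · rintro ⟨a, hW, rfl⟩
    refine ⟨key0 a, ?_⟩
    have h1 := key a 0 (Nat.zero_le _)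
    rw [pow_zero] at h1
    rwa [key a k le_rfl, h1]

theorem monomial_mem_windowCode {σ : L ≃ₐ[K] L} {k : ℕ} (hkm : k < orderOf σ) {W : Set (L × L)}
    (hW : (0, 0) ∈ W) (c : L) {i : ℕ} (hi : 1 ≤ i) (hik : i < k) :
    c • (σ ^ i).toLinearMap ∈ windowCode σ k W := by
  rw [mem_windowCode_iff hkm]
  refine ⟨Pi.single i c, ?_, ?_⟩
  · rwa [Pi.single_eq_of_ne (by omega), Pi.single_eq_of_ne (by omega)]
  · rw [Finset.sum_eq_single i]
    · simp
    · intro j _ hj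
      simp [Pi.single_eq_of_ne hj]
    · intro h
      exact absurd (Finset.mem_range.2 (by omega)) h

theorem galCoeff_binomial_one {τ : L ≃ₐ[K] L} (hτ : τ ≠ 1) (a b : L) :
    galCoeff (a • (1 : L ≃ₐ[K] L).toLinearMap + b • τ.toLinearMap) 1 = a := by
  rw [galCoeff_add, galCoeff_smul_toLinearMap, galCoeff_smul_toLinearMap, if_pos rfl, if_neg hτ,
    add_zero]

theorem galCoeff_binomial_right {τ : L ≃ₐ[K] L} (hτ : τ ≠ 1) (a b : L) :
    galCoeff (a • (1 : L ≃ₐ[K] L).toLinearMap + b • τ.toLinearMap) τ = b := by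
  rw [galCoeff_add, galCoeff_smul_toLinearMap, galCoeff_smul_toLinearMap, if_neg hτ.symm,
    if_pos rfl, zero_add]

theorem binomial_mem_windowCode {σ : L ≃ₐ[K] L} {k : ℕ} (hk : 1 ≤ k) (hkm : k < orderOf σ)
    {W : Set (L × L)} {a b : L} (hW : (a, b) ∈ W) :
    a • (1 : L ≃ₐ[K] L).toLinearMap + b • (σ ^ k).toLinearMap ∈ windowCode σ k W := by
  have hne : σ ^ k ≠ 1 := pow_ne_one_of_lt_orderOf (by omega) hkm
  refine ⟨fun g hg => ?_, ?_⟩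
  · have h1 := hg 0 (Nat.zero_le _)
    rw [pow_zero] at h1
    rw [galCoeff_add, galCoeff_smul_toLinearMap, galCoeff_smul_toLinearMap, if_neg h1.symm,
      if_neg (hg k le_rfl).symm, add_zero]
  · rwa [galCoeff_binomial_one hne, galCoeff_binomial_right hne]

end GaloisCoefficients

/-! ### Idealizers and their invariance under equivalence -/

section Idealizers

/-- The left idealizer `{x | x S ⊆ S}` of a subset of a ring. -/
def leftIdealizer {R : Type*} [Mul R] (S : Set R) : Set R := {x | ∀ y ∈ S, x * y ∈ S}

/-- The right idealizer `{x | S x ⊆ S}` of a subset of a ring. -/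
def rightIdealizer {R : Type*} [Mul R] (S : Set R) : Set R := {x | ∀ y ∈ S, y * x ∈ S}

theorem image_leftIdealizer {R R' : Type*} [Mul R] [Mul R'] (e : R ≃* R') (S : Set R) :
    e '' leftIdealizer S = leftIdealizer (e '' S) := by
  ext x
  obtain ⟨x, rfl⟩ := e.surjective x
  simp [leftIdealizer, e.injective.eq_iff, ← map_mul]

theorem image_rightIdealizer {R R' : Type*} [Mul R] [Mul R'] (e : R ≃* R') (S : Set R) :
    e '' rightIdealizer S = rightIdealizer (e '' S) := by
  ext x
  obtain ⟨x, rfl⟩ := e.surjective x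
  simp [rightIdealizer, e.injective.eq_iff, ← map_mul]

theorem ncard_leftIdealizer_image {R R' : Type*} [Mul R] [Mul R'] (e : R ≃* R') (S : Set R) :
    (leftIdealizer (e '' S)).ncard = (leftIdealizer S).ncard := by
  rw [← image_leftIdealizer, Set.ncard_image_of_injective _ e.injective]

theorem ncard_rightIdealizer_image {R R' : Type*} [Mul R] [Mul R'] (e : R ≃* R') (S : Set R) :
    (rightIdealizer (e '' S)).ncard = (rightIdealizer S).ncard := by
  rw [← image_rightIdealizer, Set.ncard_image_of_injective _ e.injective]

/-- Conjugation by a unit, as a multiplicative automorphism of the whole monoid. -/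
def unitConj {R : Type*} [Monoid R] (u : Rˣ) : R ≃* R where
  toFun x := u * x * (u⁻¹ : Rˣ)
  invFun x := (u⁻¹ : Rˣ) * x * u
  left_inv x := by simp [mul_assoc]
  right_inv x := by simp [mul_assoc]
  map_mul' x y := by simp [mul_assoc]

theorem unitConj_apply {R : Type*} [Monoid R] (u : Rˣ) (x : R) :
    unitConj u x = u * x * (u⁻¹ : Rˣ) := rfl

theorem leftIdealizer_mul_unit {R : Type*} [Monoid R] (v : Rˣ) (S : Set R) :
    leftIdealizer ((fun x => x * (v : R)) '' S) = leftIdealizer S := by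
  ext x
  simp [leftIdealizer, ← mul_assoc, v.isUnit.mul_left_inj]

theorem rightIdealizer_unit_mul {R : Type*} [Monoid R] (u : Rˣ) (S : Set R) :
    rightIdealizer ((fun x => (u : R) * x) '' S) = rightIdealizer S := by
  ext x
  simp [rightIdealizer, mul_assoc, u.isUnit.mul_right_inj]

/-- Since `u S v = (u S u⁻¹) (u v)`, the set is a conjugate of `S` times a unit on the right, and
that unit does not affect the left idealizer. -/
theorem ncard_leftIdealizer_units {R : Type*} [Monoid R] (u v : Rˣ) (S : Set R) :
    (leftIdealizer ((fun x => (u : R) * x * v) '' S)).ncard = (leftIdealizer S).ncard := by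
  have h : (fun x => (u : R) * x * v) '' S
      = (fun x => x * ((u * v : Rˣ) : R)) '' (unitConj u '' S) := by
    rw [Set.image_image]
    simp [unitConj_apply, mul_assoc]
  rw [h, leftIdealizer_mul_unit, ncard_leftIdealizer_image]

theorem ncard_rightIdealizer_units {R : Type*} [Monoid R] (u v : Rˣ) (S : Set R) :
    (rightIdealizer ((fun x => (u : R) * x * v) '' S)).ncard = (rightIdealizer S).ncard := by
  have h : (fun x => (u : R) * x * v) '' S
      = (fun x => ((u * v : Rˣ) : R) * x) '' (unitConj v⁻¹ '' S) := by
    rw [Set.image_image]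
    simp [unitConj_apply, mul_assoc]
  rw [h, rightIdealizer_unit_mul, ncard_rightIdealizer_image]

/-- Codes that are equivalent, the second one being additive, differ by a ring automorphism of
the entries and by invertible factors only. -/
theorem Equivalent.eq_image {K : Type*} [Field K] {m : ℕ} {C₁ C₂ : Set (Matrix (Fin m) (Fin m) K)}
    (h : Equivalent C₁ C₂) (h0 : 0 ∈ C₁) (hadd : ∀ x ∈ C₂, ∀ y ∈ C₂, x + y ∈ C₂)
    (hsub : ∀ x ∈ C₂, ∀ y ∈ C₂, x - y ∈ C₂) :
    ∃ (A B : (Matrix (Fin m) (Fin m) K)ˣ) (ρ : K ≃+* K),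
      C₂ = (fun x => (A : Matrix (Fin m) (Fin m) K) * x * B) ''
        ((ρ.mapMatrix : Matrix (Fin m) (Fin m) K ≃+* _).toMulEquiv '' C₁) := by
  obtain ⟨A, B, C, ρ, h⟩ := h
  -- The image of `0` is `C` itself, so the translation can be absorbed into the additive code `C₂`.
  have hC : C ∈ C₂ := by
    rw [h]
    exact ⟨0, h0, by simp⟩
  refine ⟨A, B, ρ, ?_⟩
  rw [Set.image_image]
  ext N
  constructor
  · intro hN
    have := hadd N hN C hC
    rw [h] at this
    obtain ⟨M, hM, hNM⟩ := this
    exact ⟨M, hM, (add_right_cancel hNM).symm⟩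
  · rintro ⟨M, hM, rfl⟩
    have h2 : (A : Matrix (Fin m) (Fin m) K) * M.map ρ * (B : Matrix (Fin m) (Fin m) K) + C
        ∈ C₂ := by
      rw [h]
      exact ⟨M, hM, rfl⟩
    have h3 := hsub _ h2 C hC
    rw [add_sub_cancel_right] at h3
    exact h3

theorem matrixCode_eq_image {K L : Type*} [Field K] [Field L] [Algebra K L] {m : ℕ}
    (β : Module.Basis (Fin m) K L) (S : Set (L →ₗ[K] L)) :
    matrixCode β S = (LinearMap.toMatrixAlgEquiv β).toMulEquiv '' S := by
  ext M
  constructor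
  · rintro ⟨f, hf, rfl⟩
    exact ⟨f, hf, rfl⟩
  · rintro ⟨f, hf, rfl⟩
    exact ⟨f, hf, rfl⟩

/-- Only multiplicative isomorphisms are needed, so the entrywise action of `ρ`, which need not be
`K`-linear, is treated like the passage from maps to matrices. -/
theorem ncard_idealizers_eq_of_equivalent {K L : Type*} [Field K] [Field L] [Algebra K L] {m : ℕ}
    {β : Module.Basis (Fin m) K L} {S₁ S₂ : Set (L →ₗ[K] L)}
    (h : Equivalent (matrixCode β S₁) (matrixCode β S₂)) (h0 : 0 ∈ S₁)
    (hadd : ∀ x ∈ S₂, ∀ y ∈ S₂, x + y ∈ S₂) (hsub : ∀ x ∈ S₂, ∀ y ∈ S₂, x - y ∈ S₂) :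
    (leftIdealizer S₂).ncard = (leftIdealizer S₁).ncard ∧
      (rightIdealizer S₂).ncard = (rightIdealizer S₁).ncard := by
  obtain ⟨A, B, ρ, hAB⟩ := h.eq_image ⟨0, h0, by simp⟩
    (by
      rintro _ ⟨f, hf, rfl⟩ _ ⟨g, hg, rfl⟩
      exact ⟨f + g, hadd f hf g hg, by simp⟩)
    (by
      rintro _ ⟨f, hf, rfl⟩ _ ⟨g, hg, rfl⟩
      exact ⟨f - g, hsub f hf g hg, by simp⟩)
  rw [matrixCode_eq_image, matrixCode_eq_image] at hAB
  constructor
  · rw [← ncard_leftIdealizer_image (LinearMap.toMatrixAlgEquiv β).toMulEquiv, hAB,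
      ncard_leftIdealizer_units, ncard_leftIdealizer_image, ncard_leftIdealizer_image]
  · rw [← ncard_rightIdealizer_image (LinearMap.toMatrixAlgEquiv β).toMulEquiv, hAB,
      ncard_rightIdealizer_units, ncard_rightIdealizer_image, ncard_rightIdealizer_image]

end Idealizers

end RankMetric

namespace RankMetric

/-! ### Idealizers of window codes consist of scalars -/

/-- A function on a cyclic group that vanishes outside `1` because of its vanishing on translates
of the window `1, σ, …, σ^k`. -/
theorem eq_zero_of_window_vanishing {G M : Type*} [Group G] [Zero M] {σ : G}
    (hσ : ∀ g, ∃ j < orderOf σ, σ ^ j = g) {k : ℕ} (hk : 1 ≤ k) (hm : 3 ≤ orderOf σ) {φ : G → M}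
    (hinner : ∀ i, 1 ≤ i → i < k → ∀ g, g * σ ^ i = 1 → φ g = 0 ∧ φ (g * σ ^ k) = 0)
    (houter : 1 < k → ∀ g, (∀ i ≤ k, g * σ ≠ σ ^ i) → φ g = 0)
    (hends : ∀ g, (∀ i ≤ k, g * σ ^ k ≠ σ ^ i) → φ g = 0 ∧ φ (g * σ ^ k) = 0) :
    ∀ g, g ≠ 1 → φ g = 0 := by
  intro g hg
  obtain ⟨j, hj, rfl⟩ := hσ g
  have hj0 : j ≠ 0 := by
    rintro rfl
    exact hg (pow_zero σ)
  rcases Nat.lt_or_ge 1 k with hk1 | hk1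
  -- For `k > 1`, `hinner` covers the exponents `1, …, k - 1` and their negatives; for the remaining
  -- `j`, `σ^(j+1)` lies outside the window and `houter` applies.
  · rcases Nat.lt_or_ge j k with hjk | hjk
    · have h := (hinner (k - j) (by omega) (by omega) ((σ ^ (k - j))⁻¹) (by simp)).2
      have e : (σ ^ (k - j))⁻¹ * σ ^ k = σ ^ j := by
        rw [inv_mul_eq_iff_eq_mul, ← pow_add]
        congr 1
        omega
      rwa [e] at h
    · rcases Nat.lt_or_ge (orderOf σ - j) k with hjm | hjm
      · refine (hinner (orderOf σ - j) (by omega) hjm _ ?_).1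
        rw [← pow_add, Nat.add_sub_cancel' hj.le, pow_orderOf_eq_one]
      · refine houter hk1 _ fun i hi h => ?_
        rw [← pow_succ, pow_eq_pow_of_lt_orderOf (by omega) (by omega)] at h
        omega
  -- Without inner monomials only `hends` is left. It reaches `j = 1` because `σ²` is not in `{1,
  -- σ}`, which needs order at least 3.
  · obtain rfl : k = 1 := by omega
    rcases Nat.lt_or_ge 1 j with hj1 | hj1
    · have h := (hends (σ ^ (j - 1)) ?_).2
      · rwa [← pow_add, Nat.sub_add_cancel hj1.le] at h
      · intro i hi h
        rw [← pow_add, pow_eq_pow_of_lt_orderOf (by omega) (by omega)] at h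
        omega
    · obtain rfl : j = 1 := by omega
      refine (hends _ fun i hi h => ?_).1
      rw [← pow_add, pow_eq_pow_of_lt_orderOf (by omega) (by omega)] at h
      omega

section WindowCode

variable {K L : Type*} [Field K] [Field L] [Algebra K L]

/-- `W` contains no nonzero graph-like line `{(u c, v T(c))}` and is annihilated by no nonzero
form `u T(a) + v b`. -/
structure Transversal (T : L ≃ₐ[K] L) (W : Set (L × L)) : Prop where
  zero_mem : (0, 0) ∈ W
  line : ∀ u v : L, (∀ c, (u * c, v * T c) ∈ W) → u = 0 ∧ v = 0
  form : ∀ u v : L, (∀ a b, (a, b) ∈ W → u * T a + v * b = 0) → u = 0 ∧ v = 0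

/-- The pairs of end coefficients of the code `D_{k,s}(γ)`. -/
def splitPairs (θ : L ≃ₐ[K] L) (γ : L) : Set (L × L) :=
  {p | θ p.1 = p.1 ∧ ∃ b, θ b = b ∧ p.2 = γ * b}

/-- The pairs of end coefficients of a twisted Gabidulin code. -/
def twistedPairs (τ : L ≃ₐ[K] L) (η : L) : Set (L × L) :=
  {p | p.2 = η * τ p.1}

/-- A nonzero multiple of `L` is all of `L` and does not fit into the proper subfield fixed by `θ`,
nor into `γ` times it. The pairs `(1, 0)` and `(0, γ)` defeat every nonzero form. -/
theorem transversal_splitPairs {θ : L ≃ₐ[K] L} (hθ : θ ≠ 1) {γ : L} (hγ : γ ≠ 0)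
    (T : L ≃ₐ[K] L) : Transversal T (splitPairs θ γ) where
  zero_mem := ⟨map_zero θ, 0, map_zero θ, (mul_zero γ).symm⟩
  line u v h := by
    obtain ⟨x, hx⟩ : ∃ x, θ x ≠ x := by
      by_contra! hcon
      exact hθ (AlgEquiv.ext hcon)
    constructor
    · by_contra hu
      have := (h (u⁻¹ * x)).1
      rw [mul_inv_cancel_left₀ hu] at this
      exact hx this
    · by_contra hv
      obtain ⟨b, hb, hvb⟩ := (h (T⁻¹ (v⁻¹ * (γ * x)))).2
      have e : T (T⁻¹ (v⁻¹ * (γ * x))) = v⁻¹ * (γ * x) := T.apply_symm_apply _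
      simp only [e, mul_inv_cancel_left₀ hv] at hvb
      rw [mul_left_cancel₀ hγ hvb] at hx
      exact hx hb
  form u v h := by
    have h1 := h 1 0 ⟨map_one θ, 0, map_zero θ, (mul_zero γ).symm⟩
    have h2 := h 0 γ ⟨map_zero θ, 1, map_one θ, (mul_one γ).symm⟩
    simp [hγ] at h1 h2
    exact ⟨h1, h2⟩

/-- A bad line or form would make `T` and `τ` proportional over `L`; evaluation at `1` then gives `τ
= T`, unless the factors vanish. -/
theorem transversal_twistedPairs {τ T : L ≃ₐ[K] L} (hτ : τ ≠ T) {η : L} (hη : η ≠ 0) :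
    Transversal T (twistedPairs τ η) where
  zero_mem := by simp [twistedPairs]
  line u v h := by
    have h' : ∀ c, v * T c = η * τ u * τ c := fun c => by
      have := h c
      simpa [twistedPairs, mul_assoc] using this
    have h1 := h' 1
    simp only [map_one, mul_one] at h1
    by_cases hv : v = 0
    · rw [hv] at h1
      simpa [hη, hv] using h1
    · refine absurd (AlgEquiv.ext fun c => ?_) hτ
      have := h' c
      rw [← h1] at this
      exact (mul_left_cancel₀ hv this).symm
  form u v h := by
    have h' : ∀ a, u * T a = -(v * η) * τ a := fun a => by
      have := h a (η * τ a) rfl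
      linear_combination this
    have h1 := h' 1
    simp only [map_one, mul_one] at h1
    by_cases hu : u = 0
    · rw [hu] at h1
      simpa [hη, hu] using h1
    · refine absurd (AlgEquiv.ext fun c => ?_) hτ
      have := h' c
      rw [← h1] at this
      exact (mul_left_cancel₀ hu this).symm

theorem scalar_injective :
    Function.Injective fun c : L => c • (1 : L ≃ₐ[K] L).toLinearMap := by
  intro c d h
  simpa using LinearMap.congr_fun h 1

variable [FiniteDimensional K L] [IsGalois K L]

/-- Testing `φ` on inner monomials puts a line into `W`, and testing it on binomials `a + b σ^k`
makes a form vanish on `W`. Moving coefficients past `φ` twists one entry by `σ ^ k`, hence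
`Transversal (σ ^ k)`; on the right side, where `φ` comes last, the twist is trivial. -/
theorem galCoeff_eq_zero_of_mem_leftIdealizer {σ : L ≃ₐ[K] L}
    (hσ : ∀ g, ∃ j < orderOf σ, σ ^ j = g) {k : ℕ} (hk : 1 ≤ k) (hkm : k < orderOf σ)
    (hm : 3 ≤ orderOf σ) {W : Set (L × L)} (hW : Transversal (σ ^ k) W) {φ : L →ₗ[K] L}
    (hφ : φ ∈ leftIdealizer (windowCode σ k W)) : ∀ g, g ≠ 1 → galCoeff φ g = 0 := by
  refine eq_zero_of_window_vanishing hσ hk hm ?_ ?_ ?_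
  · intro i hi hik g hg
    refine hW.line _ _ fun c => ?_
    -- The factor `g⁻¹ c` makes the end coefficients `φ_g c` and `φ_{g σ^k} σ^k(c)`.
    have h := (hφ _ (monomial_mem_windowCode hkm hW.zero_mem (g⁻¹ c) hi hik)).2
    have e : g * σ ^ k * σ ^ i = σ ^ k := by
      rw [mul_assoc, (Commute.refl σ).pow_pow k i |>.eq, ← mul_assoc, hg, one_mul]
    have hc : g * σ ^ k = σ ^ k * g := by
      rw [eq_inv_of_mul_eq_one_left hg]
      exact ((Commute.refl σ).pow_pow i k).inv_left.eq
    rw [← hg, galCoeff_mul_smul] at h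
    have e' := galCoeff_mul_smul φ (g⁻¹ c) (σ ^ i) (g * σ ^ k)
    rw [e, hc, AlgEquiv.mul_apply] at e'
    rw [e'] at h
    have hgc : g (g⁻¹ c) = c := g.apply_symm_apply c
    rw [hgc] at h
    rwa [hc]
  · intro hk1 g hg
    have h := (hφ _ (monomial_mem_windowCode hkm hW.zero_mem 1 le_rfl hk1)).1 (g * σ) hg
    rw [pow_one, galCoeff_mul_smul, map_one, mul_one] at h
    exact h
  · intro g hg
    have h : g⁻¹ (galCoeff φ (g * σ ^ k)) = 0 ∧ g⁻¹ (galCoeff φ g) = 0 := by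
      refine hW.form _ _ fun a b hab => ?_
      have h := (hφ _ (binomial_mem_windowCode hk hkm hab)).1 (g * σ ^ k) hg
      rw [mul_add, galCoeff_add, galCoeff_mul_smul] at h
      -- The term `a` is a monomial at the identity, so the index is written with a trailing factor
      -- `1`.
      nth_rewrite 1 [← mul_one (g * σ ^ k)] at h
      rw [galCoeff_mul_smul] at h
      have hgc : ∀ c, g⁻¹ (g c) = c := g.symm_apply_apply
      have h' := congrArg (g⁻¹ : L ≃ₐ[K] L) h
      rwa [map_add, map_mul, map_mul, map_zero, AlgEquiv.mul_apply, hgc, hgc] at h'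
    exact ⟨(map_eq_zero _).1 h.2, (map_eq_zero _).1 h.1⟩

theorem galCoeff_eq_zero_of_mem_rightIdealizer {σ : L ≃ₐ[K] L}
    (hσ : ∀ g, ∃ j < orderOf σ, σ ^ j = g) {k : ℕ} (hk : 1 ≤ k) (hkm : k < orderOf σ)
    (hm : 3 ≤ orderOf σ) {W : Set (L × L)} (hW : Transversal (1 : L ≃ₐ[K] L) W) {φ : L →ₗ[K] L}
    (hφ : φ ∈ rightIdealizer (windowCode σ k W)) : ∀ g, g ≠ 1 → galCoeff φ g = 0 := by
  have hcomm : ∀ g (i : ℕ), g * σ ^ i = σ ^ i * g := by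
    intro g i
    obtain ⟨j, -, rfl⟩ := hσ g
    exact ((Commute.refl σ).pow_pow j i).eq
  refine eq_zero_of_window_vanishing hσ hk hm ?_ ?_ ?_
  · intro i hi hik g hg
    have h : (σ ^ i) (galCoeff φ g) = 0 ∧ (σ ^ i) (galCoeff φ (g * σ ^ k)) = 0 := by
      refine hW.line _ _ fun c => ?_
      have h := (hφ _ (monomial_mem_windowCode hkm hW.zero_mem c hi hik)).2
      have e : σ ^ i * (g * σ ^ k) = σ ^ k := by
        rw [← mul_assoc, ← hcomm, hg, one_mul]
      rw [← hg, hcomm, galCoeff_smul_mul] at h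
      have e' := galCoeff_smul_mul φ c (σ ^ i) (g * σ ^ k)
      rw [e] at e'
      rw [e'] at h
      rw [AlgEquiv.one_apply, mul_comm _ c, mul_comm _ c]
      exact h
    exact ⟨(map_eq_zero _).1 h.1, (map_eq_zero _).1 h.2⟩
  · intro hk1 g hg
    have h := (hφ _ (monomial_mem_windowCode hkm hW.zero_mem 1 le_rfl hk1)).1 (g * σ) hg
    have hc := hcomm g 1
    rw [pow_one] at hc
    rw [pow_one, hc, galCoeff_smul_mul, one_mul] at h
    exact (map_eq_zero _).1 h
  · intro g hg
    have h : galCoeff φ (g * σ ^ k) = 0 ∧ (σ ^ k) (galCoeff φ g) = 0 := by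
      refine hW.form _ _ fun a b hab => ?_
      have h := (hφ _ (binomial_mem_windowCode hk hkm hab)).1 (g * σ ^ k) hg
      rw [add_mul, galCoeff_add] at h
      nth_rewrite 1 [← one_mul (g * σ ^ k)] at h
      rw [galCoeff_smul_mul, hcomm, galCoeff_smul_mul] at h
      rw [AlgEquiv.one_apply, hcomm, mul_comm _ a, mul_comm _ b]
      exact h
    exact ⟨(map_eq_zero _).1 h.2, h.1⟩

theorem galCoeff_scalar_mul (c : L) (f : L →ₗ[K] L) (g : L ≃ₐ[K] L) :
    galCoeff ((c • (1 : L ≃ₐ[K] L).toLinearMap) * f) g = c * galCoeff f g := by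
  have h := galCoeff_smul_mul f c 1 g
  rwa [one_mul] at h

theorem galCoeff_mul_scalar (c : L) (f : L →ₗ[K] L) (g : L ≃ₐ[K] L) :
    galCoeff (f * (c • (1 : L ≃ₐ[K] L).toLinearMap)) g = galCoeff f g * g c := by
  have h := galCoeff_mul_smul f c 1 g
  rwa [mul_one] at h

theorem eq_scalar_of_galCoeff_eq_zero {φ : L →ₗ[K] L} (h : ∀ g, g ≠ 1 → galCoeff φ g = 0) :
    φ = galCoeff φ 1 • (1 : L ≃ₐ[K] L).toLinearMap := by
  refine galCoeff_ext fun g => ?_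
  rw [galCoeff_smul_toLinearMap]
  split_ifs with hg
  · rw [hg]
  · exact h g (Ne.symm hg)

theorem scalar_mem_leftIdealizer {σ : L ≃ₐ[K] L} {k : ℕ} {W : Set (L × L)} {c : L}
    (hc : ∀ a b, (a, b) ∈ W → (c * a, c * b) ∈ W) :
    c • (1 : L ≃ₐ[K] L).toLinearMap ∈ leftIdealizer (windowCode σ k W) := by
  intro f hf
  refine ⟨fun g hg => ?_, ?_⟩
  · rw [galCoeff_scalar_mul, hf.1 g hg, mul_zero]
  · rw [galCoeff_scalar_mul, galCoeff_scalar_mul]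
    exact hc _ _ hf.2

theorem scalar_mem_rightIdealizer {σ : L ≃ₐ[K] L} {k : ℕ} {W : Set (L × L)} {c : L}
    (hc : ∀ a b, (a, b) ∈ W → (a * c, b * (σ ^ k) c) ∈ W) :
    c • (1 : L ≃ₐ[K] L).toLinearMap ∈ rightIdealizer (windowCode σ k W) := by
  intro f hf
  refine ⟨fun g hg => ?_, ?_⟩
  · rw [galCoeff_mul_scalar, hf.1 g hg, zero_mul]
  · rw [galCoeff_mul_scalar, galCoeff_mul_scalar]
    exact hc _ _ hf.2

theorem ncard_leftIdealizer_windowCode {σ : L ≃ₐ[K] L}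
    (hσ : ∀ g, ∃ j < orderOf σ, σ ^ j = g) {k : ℕ} (hk : 1 ≤ k) (hkm : k < orderOf σ)
    (hm : 3 ≤ orderOf σ) {W : Set (L × L)} (hW : Transversal (σ ^ k) W) :
    (leftIdealizer (windowCode σ k W)).ncard =
      {c : L | ∀ a b, (a, b) ∈ W → (c * a, c * b) ∈ W}.ncard := by
  rw [← Set.ncard_image_of_injective _ (scalar_injective (K := K) (L := L))]
  congr 1
  ext φ
  constructor
  · intro hφ
    have e := eq_scalar_of_galCoeff_eq_zero
      (galCoeff_eq_zero_of_mem_leftIdealizer hσ hk hkm hm hW hφ)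
    refine ⟨galCoeff φ 1, fun a b hab => ?_, e.symm⟩
    have hne : σ ^ k ≠ 1 := pow_ne_one_of_lt_orderOf (by omega) hkm
    rw [e] at hφ
    have h := (hφ _ (binomial_mem_windowCode hk hkm hab)).2
    rwa [galCoeff_scalar_mul, galCoeff_scalar_mul, galCoeff_binomial_one hne,
      galCoeff_binomial_right hne] at h
  · rintro ⟨c, hc, rfl⟩
    exact scalar_mem_leftIdealizer hc

theorem ncard_rightIdealizer_windowCode {σ : L ≃ₐ[K] L}
    (hσ : ∀ g, ∃ j < orderOf σ, σ ^ j = g) {k : ℕ} (hk : 1 ≤ k) (hkm : k < orderOf σ)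
    (hm : 3 ≤ orderOf σ) {W : Set (L × L)} (hW : Transversal (1 : L ≃ₐ[K] L) W) :
    (rightIdealizer (windowCode σ k W)).ncard =
      {c : L | ∀ a b, (a, b) ∈ W → (a * c, b * (σ ^ k) c) ∈ W}.ncard := by
  rw [← Set.ncard_image_of_injective _ (scalar_injective (K := K) (L := L))]
  congr 1
  ext φ
  constructor
  · intro hφ
    have e := eq_scalar_of_galCoeff_eq_zero
      (galCoeff_eq_zero_of_mem_rightIdealizer hσ hk hkm hm hW hφ)
    refine ⟨galCoeff φ 1, fun a b hab => ?_, e.symm⟩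
    have hne : σ ^ k ≠ 1 := pow_ne_one_of_lt_orderOf (by omega) hkm
    rw [e] at hφ
    have h := (hφ _ (binomial_mem_windowCode hk hkm hab)).2
    rwa [galCoeff_mul_scalar, galCoeff_mul_scalar, galCoeff_binomial_one hne,
      galCoeff_binomial_right hne, AlgEquiv.one_apply] at h
  · rintro ⟨c, hc, rfl⟩
    exact scalar_mem_rightIdealizer hc

end WindowCode

end RankMetric

namespace RankMetric

/-! ### Fixed fields and the scalars in the idealizers -/

theorem ncard_fixed_pow_orderOf {K L : Type*} [Field K] [Field L] [Algebra K L]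
    [FiniteDimensional K L] (g : L ≃ₐ[K] L) :
    {x : L | g x = x}.ncard ^ orderOf g = Nat.card L := by
  have h := Module.natCard_eq_pow_finrank
    (K := IntermediateField.fixedField (Subgroup.zpowers g)) (V := L)
  rw [IntermediateField.finrank_fixedField_eq_card, Nat.card_zpowers] at h
  rw [h]
  congr 1
  rw [← Nat.card_coe_set_eq]
  refine Nat.card_congr (Equiv.setCongr (Set.ext fun x => ?_))
  rw [SetLike.mem_coe, IntermediateField.mem_fixedField_iff]
  constructor
  · intro hx f hf
    have hle : Subgroup.zpowers g ≤ MulAction.stabilizer (L ≃ₐ[K] L) x :=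
      Subgroup.zpowers_le.2 hx
    exact hle hf
  · intro hx
    exact hx g (Subgroup.mem_zpowers g)

/-- `L` has degree `orderOf g` over the fixed field of `g`, whose size is at least 2, so that size
determines the exponent. -/
theorem orderOf_eq_of_ncard_fixed_eq {K L : Type*} [Field K] [Field L] [Algebra K L] [Finite L]
    [FiniteDimensional K L] {g g' : L ≃ₐ[K] L}
    (h : {x : L | g x = x}.ncard = {x : L | g' x = x}.ncard) : orderOf g = orderOf g' := by
  have h1 := ncard_fixed_pow_orderOf g
  rw [h, ← ncard_fixed_pow_orderOf g'] at h1
  refine Nat.pow_right_injective ?_ h1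
  exact (Set.one_lt_ncard_iff (Set.toFinite _)).2
    ⟨0, 1, map_zero g', map_one g', zero_ne_one⟩

section ScalarConditions

variable {K L : Type*} [Field K] [Field L] [Algebra K L]

theorem left_scalars_splitPairs (θ : L ≃ₐ[K] L) (γ : L) :
    {c : L | ∀ a b, (a, b) ∈ splitPairs θ γ → (c * a, c * b) ∈ splitPairs θ γ} =
      {c | θ c = c} := by
  ext c
  constructor
  · intro h
    have := (h 1 0 ⟨map_one θ, 0, map_zero θ, (mul_zero γ).symm⟩).1
    simpa using this
  · rintro hc a b ⟨ha, b, hb, rfl⟩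
    refine ⟨?_, c * b, ?_, mul_left_comm _ _ _⟩
    · change θ (c * a) = c * a
      rw [map_mul, hc, ha]
    · rw [map_mul, hc, hb]

theorem right_scalars_splitPairs {θ σ : L ≃ₐ[K] L} (hθσ : θ * σ = σ * θ) (γ : L) :
    {c : L | ∀ a b, (a, b) ∈ splitPairs θ γ → (a * c, b * σ c) ∈ splitPairs θ γ} =
      {c | θ c = c} := by
  ext c
  constructor
  · intro h
    have := (h 1 0 ⟨map_one θ, 0, map_zero θ, (mul_zero γ).symm⟩).1
    simpa using this
  · rintro hc a b ⟨ha, b, hb, rfl⟩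
    refine ⟨?_, b * σ c, ?_, mul_assoc _ _ _⟩
    · change θ (a * c) = a * c
      rw [map_mul, hc, ha]
    · rw [map_mul, hb, ← AlgEquiv.mul_apply, hθσ, AlgEquiv.mul_apply, hc]

theorem left_scalars_twistedPairs (τ : L ≃ₐ[K] L) {η : L} (hη : η ≠ 0) :
    {c : L | ∀ a b, (a, b) ∈ twistedPairs τ η → (c * a, c * b) ∈ twistedPairs τ η} =
      {c | τ c = c} := by
  ext c
  constructor
  · intro h
    have h1 : c * η = η * τ (c * 1) := h 1 η (by simp [twistedPairs])
    rw [mul_one, mul_comm] at h1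
    exact (mul_left_cancel₀ hη h1).symm
  · rintro hc a b hab
    obtain rfl : b = η * τ a := hab
    change c * (η * τ a) = η * τ (c * a)
    rw [map_mul, hc, mul_left_comm]

/-- The condition is `σ c = τ c`; rewriting it as a fixed-point equation lets the order be read off
from the number of solutions. -/
theorem right_scalars_twistedPairs (τ σ : L ≃ₐ[K] L) {η : L} (hη : η ≠ 0) :
    {c : L | ∀ a b, (a, b) ∈ twistedPairs τ η → (a * c, b * σ c) ∈ twistedPairs τ η} =
      {c | (τ⁻¹ * σ) c = c} := by
  have hτ : ∀ c, (τ⁻¹ * σ) c = c ↔ σ c = τ c := fun c => τ.symm_apply_eq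
  ext c
  rw [Set.mem_ofPred_eq, Set.mem_ofPred_eq, hτ]
  constructor
  · intro h
    have h1 : η * σ c = η * τ (1 * c) := h 1 η (by simp [twistedPairs])
    rw [one_mul] at h1
    exact mul_left_cancel₀ hη h1
  · rintro hc a b hab
    obtain rfl : b = η * τ a := hab
    change η * τ a * σ c = η * τ (a * c)
    rw [map_mul, hc, mul_assoc]

end ScalarConditions

/-! ### The concrete codes over finite fields -/

section FiniteFields

variable (K : Type*) {L : Type*} [Field K] [Fintype K] [Field L] [Algebra K L]

theorem qMonomial_add (c d : L) (j : ℕ) :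
    qMonomial K (c + d) j = qMonomial K c j + qMonomial K d j := by
  simp [qMonomial, add_smul]

theorem qMonomial_sub (c d : L) (j : ℕ) :
    qMonomial K (c - d) j = qMonomial K c j - qMonomial K d j := by
  ext x
  simp [qMonomial_apply, sub_mul]

variable {K} in
theorem gabidulin_add_mem {l t : ℕ} : ∀ x ∈ gabidulin K L l t, ∀ y ∈ gabidulin K L l t,
    x + y ∈ gabidulin K L l t := by
  rintro _ ⟨a, rfl⟩ _ ⟨b, rfl⟩
  exact ⟨fun i => a i + b i, by simp only [qMonomial_add, Finset.sum_add_distrib]⟩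

variable {K} in
theorem gabidulin_sub_mem {l t : ℕ} : ∀ x ∈ gabidulin K L l t, ∀ y ∈ gabidulin K L l t,
    x - y ∈ gabidulin K L l t := by
  rintro _ ⟨a, rfl⟩ _ ⟨b, rfl⟩
  exact ⟨fun i => a i - b i, by simp only [qMonomial_sub, Finset.sum_sub_distrib]⟩

variable {K} in
theorem scalar_mem_leftIdealizer_gabidulin (l t : ℕ) (c : L) :
    c • (1 : L ≃ₐ[K] L).toLinearMap ∈ leftIdealizer (gabidulin K L l t) := by
  rintro _ ⟨a, rfl⟩
  refine ⟨fun i => c * a i, ?_⟩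
  ext x
  simp [qMonomial_apply, Finset.mul_sum, mul_assoc]

variable [Finite L]

/-- The `q`-Frobenius of `L`, `q = |K|`, as an element of `Gal(L/K)`. -/
noncomputable abbrev frob (K L : Type*) [Field K] [Fintype K] [Field L] [Algebra K L] [Finite L] :
    L ≃ₐ[K] L :=
  FiniteField.frobeniusAlgEquivOfAlgebraic K L

theorem frob_pow_apply (j : ℕ) (x : L) : (frob K L ^ j) x = x ^ (Fintype.card K ^ j) := by
  rw [AlgEquiv.coe_pow, FiniteField.coe_frobeniusAlgEquivOfAlgebraic_iterate]

theorem qMonomial_eq_smul (c : L) (j : ℕ) :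
    qMonomial K c j = c • (frob K L ^ j).toLinearMap := by
  ext x
  rw [qMonomial_apply, LinearMap.smul_apply, AlgEquiv.toLinearMap_apply, frob_pow_apply,
    smul_eq_mul]

variable {K}

theorem orderOf_frob_pow {t : ℕ} (ht : Nat.Coprime t (Module.finrank K L)) :
    orderOf (frob K L ^ t) = Module.finrank K L := by
  rw [← FiniteField.orderOf_frobeniusAlgEquivOfAlgebraic K L] at ht ⊢
  exact ht.symm.orderOf_pow

theorem exists_pow_frob_pow_eq {t : ℕ} (ht : Nat.Coprime t (Module.finrank K L))
    (g : L ≃ₐ[K] L) : ∃ j < orderOf (frob K L ^ t), (frob K L ^ t) ^ j = g := by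
  classical
  have hcard : Nat.card (L ≃ₐ[K] L) = orderOf (frob K L ^ t) := by
    rw [orderOf_frob_pow ht, IsGalois.card_aut_eq_finrank]
  have htop := (Subgroup.card_eq_iff_eq_top (Subgroup.zpowers (frob K L ^ t))).1
    (by rw [Nat.card_zpowers, hcard])
  have hg : g ∈ Subgroup.zpowers (frob K L ^ t) := htop ▸ Subgroup.mem_top g
  rw [mem_zpowers_iff_mem_range_orderOf] at hg
  simpa using hg

theorem mem_subfieldFq_iff {n : ℕ} {a : L} : a ∈ subfieldFq K L n ↔ (frob K L ^ n) a = a := by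
  rw [frob_pow_apply]
  rfl

theorem codeD_eq_windowCode {n k s : ℕ} (hk : 1 ≤ k) (hkm : k < Module.finrank K L)
    (hs : Nat.Coprime s (Module.finrank K L)) (γ : L) :
    codeD K n k s γ = windowCode (frob K L ^ s) k (splitPairs (frob K L ^ n) γ) := by
  have hmon : ∀ (c : L) (i : ℕ),
      qMonomial K c (i * s) = c • ((frob K L ^ s) ^ i).toLinearMap := fun c i => by
    rw [qMonomial_eq_smul, mul_comm, pow_mul]
  have hsum : ∀ a : ℕ → L, ∑ i ∈ Finset.range (k + 1), a i • ((frob K L ^ s) ^ i).toLinearMap =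
      qMonomial K (a 0) 0 + ∑ i ∈ Finset.Ico 1 k, qMonomial K (a i) (i * s)
        + qMonomial K (a k) (k * s) := by
    intro a
    rw [Finset.sum_range_succ, Finset.range_eq_Ico, Finset.sum_eq_sum_Ico_succ_bot (by omega)]
    simp only [hmon, qMonomial_eq_smul, pow_zero, zero_add]
  ext f
  rw [mem_windowCode_iff (by rwa [orderOf_frob_pow hs])]
  constructor
  · rintro ⟨a, ha, b, hb, c, rfl⟩
    rw [mem_subfieldFq_iff] at ha hb
    refine ⟨fun i => if i = 0 then a else if i = k then γ * b else c i, ?_, ?_⟩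
    · simp only [if_true, if_neg (show k ≠ 0 by omega)]
      exact ⟨ha, b, hb, rfl⟩
    · rw [hsum]
      simp only [if_true, if_neg (show k ≠ 0 by omega)]
      congr 2
      refine Finset.sum_congr rfl fun i hi => ?_
      rw [Finset.mem_Ico] at hi
      rw [if_neg (by omega), if_neg (by omega)]
  · rintro ⟨a, ⟨ha, b, hb, hab⟩, rfl⟩
    refine ⟨a 0, mem_subfieldFq_iff.2 ha, b, mem_subfieldFq_iff.2 hb, a, ?_⟩
    rw [hsum, ← hab]

theorem twistedGabidulin_eq_windowCode {k t : ℕ} (hk : 1 ≤ k) (hkm : k < Module.finrank K L)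
    (ht : Nat.Coprime t (Module.finrank K L)) (η : L) (h : ℕ) :
    twistedGabidulin K k t η h = windowCode (frob K L ^ t) k (twistedPairs (frob K L ^ h) η) := by
  have hmon : ∀ (c : L) (i : ℕ),
      qMonomial K c (i * t) = c • ((frob K L ^ t) ^ i).toLinearMap := fun c i => by
    rw [qMonomial_eq_smul, mul_comm, pow_mul]
  ext f
  rw [mem_windowCode_iff (by rwa [orderOf_frob_pow ht])]
  constructor
  · rintro ⟨a, rfl⟩
    refine ⟨fun i => if i = k then η * a 0 ^ (Fintype.card K ^ h) else a i, ?_, ?_⟩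
    · simp only [if_true, if_neg (show (0 : ℕ) ≠ k by omega), ← frob_pow_apply]
      rfl
    · simp only [Finset.sum_range_succ, if_true, hmon]
      congr 1
      refine Finset.sum_congr rfl fun i hi => ?_
      rw [Finset.mem_range] at hi
      rw [if_neg (by omega)]
  · rintro ⟨a, ha, rfl⟩
    refine ⟨a, ?_⟩
    have ha' : a k = η * (frob K L ^ h) (a 0) := ha
    rw [Finset.sum_range_succ, ← frob_pow_apply, ← ha', hmon]
    simp only [hmon]

theorem eq_frob_pow_of_orderOf_eq_two {n : ℕ} (hL : Module.finrank K L = 2 * n)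
    {g : L ≃ₐ[K] L} (hg : orderOf g = 2) : g = frob K L ^ n := by
  have hm := FiniteField.orderOf_frobeniusAlgEquivOfAlgebraic K L
  -- Taking `t = 1` writes `g` as a power of `frob` itself; then `2n ∣ 2j` gives `j = n c`, and an
  -- even `c` would make `g` trivial.
  obtain ⟨j, -, rfl⟩ := exists_pow_frob_pow_eq (K := K) (L := L) (Nat.coprime_one_left _) g
  rw [pow_one] at hg ⊢
  have h2 := pow_orderOf_eq_one (frob K L ^ j)
  rw [hg, ← pow_mul, ← orderOf_dvd_iff_pow_eq_one, hm, hL, mul_comm j,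
    Nat.mul_dvd_mul_iff_left two_pos] at h2
  obtain ⟨c, rfl⟩ := h2
  rcases Nat.even_or_odd' c with ⟨d, rfl | rfl⟩
  · exfalso
    have h1 : frob K L ^ (n * (2 * d)) = 1 := by
      rw [← orderOf_dvd_iff_pow_eq_one, hm, hL]
      exact ⟨d, by ring⟩
    rw [h1, orderOf_one] at hg
    omega
  · have h1 : frob K L ^ (2 * n * d) = 1 := by
      rw [← orderOf_dvd_iff_pow_eq_one, hm, hL]
      exact dvd_mul_right _ _
    rw [show n * (2 * d + 1) = 2 * n * d + n by ring, pow_add, h1, one_mul]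

theorem twistedGabidulin_add_mem {k t h : ℕ} {η : L} :
    ∀ x ∈ twistedGabidulin K k t η h, ∀ y ∈ twistedGabidulin K k t η h,
      x + y ∈ twistedGabidulin K k t η h := by
  rintro _ ⟨a, rfl⟩ _ ⟨b, rfl⟩
  refine ⟨fun i => a i + b i, ?_⟩
  simp only [← frob_pow_apply, map_add, mul_add, qMonomial_add, Finset.sum_add_distrib]
  abel

theorem twistedGabidulin_sub_mem {k t h : ℕ} {η : L} :
    ∀ x ∈ twistedGabidulin K k t η h, ∀ y ∈ twistedGabidulin K k t η h,
      x - y ∈ twistedGabidulin K k t η h := by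
  rintro _ ⟨a, rfl⟩ _ ⟨b, rfl⟩
  refine ⟨fun i => a i - b i, ?_⟩
  simp only [← frob_pow_apply, map_sub, mul_sub, qMonomial_sub, Finset.sum_sub_distrib]
  abel

theorem zero_mem_codeD {n k s : ℕ} {γ : L} : (0 : L →ₗ[K] L) ∈ codeD K n k s γ := by
  refine ⟨0, mem_subfieldFq_iff.2 (map_zero _), 0, mem_subfieldFq_iff.2 (map_zero _), 0, ?_⟩
  simp [qMonomial]

theorem card_le_ncard_of_scalar_mem {S : Set (L →ₗ[K] L)}
    (hS : ∀ c : L, c • (1 : L ≃ₐ[K] L).toLinearMap ∈ S) : Nat.card L ≤ S.ncard := by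
  have := Module.finite_of_finite K (M := L →ₗ[K] L)
  rw [← Set.ncard_univ, ← Set.ncard_image_of_injective _ (scalar_injective (K := K) (L := L))]
  refine Set.ncard_le_ncard ?_ (Set.toFinite S)
  rintro _ ⟨c, -, rfl⟩
  exact hS c

end FiniteFields

end RankMetric

open RankMetric

/-! ### The inequivalence theorem -/

theorem corollary1 {K L : Type*} [Field K] [Fintype K] [Field L] [Algebra K L]
    (n k s : ℕ) (hn : 2 ≤ n) (hk : 1 ≤ k) (hk' : k ≤ 2 * n - 1) (hs : Nat.Coprime s (2 * n))
    (β : Module.Basis (Fin (2 * n)) K L)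
    (γ : L) (hγ : ¬ IsSquare (Algebra.norm K γ)) :
    (∀ l t : ℕ, 1 ≤ l → l ≤ 2 * n → Nat.Coprime t (2 * n) →
      ¬ RankMetric.Equivalent
        (RankMetric.matrixCode β (RankMetric.codeD K n k s γ))
        (RankMetric.matrixCode β (RankMetric.gabidulin K L l t))) ∧
    (∀ (t h : ℕ) (η : L), Nat.Coprime t (2 * n) → η ≠ 0 →
      Algebra.norm K η ≠ (-1) ^ (k * (2 * n)) →
      (k ≠ n ∨ h ≠ n) →
      ¬ RankMetric.Equivalent
        (RankMetric.matrixCode β (RankMetric.codeD K n k s γ))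
        (RankMetric.matrixCode β (RankMetric.twistedGabidulin K k t η h))) := by
  have hfd : FiniteDimensional K L := β.finiteDimensional_of_finite
  have hfin : Finite L := Module.finite_of_finite K
  have hL : Module.finrank K L = 2 * n := by simp [Module.finrank_eq_card_basis β]
  have hγ0 : γ ≠ 0 := by
    rintro rfl
    exact hγ ⟨0, by simp [Algebra.norm_zero]⟩
  have hkm : k < Module.finrank K L := by omega
  have hθ2 : orderOf (frob K L ^ n) = 2 := by
    rw [orderOf_pow, FiniteField.orderOf_frobeniusAlgEquivOfAlgebraic, hL,
      Nat.gcd_eq_right (dvd_mul_left n 2), Nat.mul_div_cancel _ (by omega)]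
  have hθ1 : frob K L ^ n ≠ 1 := by
    intro h
    rw [h, orderOf_one] at hθ2
    omega
  have hs' : Nat.Coprime s (Module.finrank K L) := by rwa [hL]
  have hDl : (leftIdealizer (codeD K n k s γ)).ncard = {x | (frob K L ^ n) x = x}.ncard := by
    rw [codeD_eq_windowCode hk hkm hs', ncard_leftIdealizer_windowCode
      (exists_pow_frob_pow_eq hs') hk (by rwa [orderOf_frob_pow hs'])
      (by rw [orderOf_frob_pow hs']; omega) (transversal_splitPairs hθ1 hγ0 _),
      left_scalars_splitPairs]
  have hDr : (rightIdealizer (codeD K n k s γ)).ncard = {x | (frob K L ^ n) x = x}.ncard := by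
    rw [codeD_eq_windowCode hk hkm hs', ncard_rightIdealizer_windowCode
      (exists_pow_frob_pow_eq hs') hk (by rwa [orderOf_frob_pow hs'])
      (by rw [orderOf_frob_pow hs']; omega) (transversal_splitPairs hθ1 hγ0 _),
      right_scalars_splitPairs]
    rw [← pow_mul]
    exact ((Commute.refl (frob K L)).pow_pow _ _).eq
  have hlt : {x | (frob K L ^ n) x = x}.ncard < Nat.card L := by
    rw [← Set.ncard_univ]
    refine Set.ncard_lt_ncard (Set.ssubset_univ_iff.2 fun h => hθ1 (AlgEquiv.ext fun x => ?_))
    exact (h ▸ Set.mem_univ x : x ∈ {x | (frob K L ^ n) x = x})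
  constructor
  · intro l t _ _ _ hE
    have hcard := (ncard_idealizers_eq_of_equivalent hE zero_mem_codeD gabidulin_add_mem
      gabidulin_sub_mem).1
    have hle := card_le_ncard_of_scalar_mem
      (scalar_mem_leftIdealizer_gabidulin (K := K) (L := L) l t)
    omega
  · intro t h η ht hη _ _ hE
    have ht' : Nat.Coprime t (Module.finrank K L) := by rwa [hL]
    obtain ⟨hl, hr⟩ := ncard_idealizers_eq_of_equivalent hE zero_mem_codeD
      twistedGabidulin_add_mem twistedGabidulin_sub_mem
    rw [twistedGabidulin_eq_windowCode hk hkm ht', hDl] at hl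
    rw [twistedGabidulin_eq_windowCode hk hkm ht', hDr] at hr
    have hkt : k < orderOf (frob K L ^ t) := by rwa [orderOf_frob_pow ht']
    have hmt : 3 ≤ orderOf (frob K L ^ t) := by
      rw [orderOf_frob_pow ht']
      omega
    -- If `τ = 1`, the end condition is `L`-linear, so every scalar is in the left idealizer,
    -- contradicting its size. Likewise `τ = σ^k` would put every scalar in the right one.
    have hτ1 : frob K L ^ h ≠ 1 := by
      intro hτ
      have hle := card_le_ncard_of_scalar_mem (K := K) (L := L)
        (S := leftIdealizer (windowCode (frob K L ^ t) k (twistedPairs (frob K L ^ h) η)))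
        fun c => scalar_mem_leftIdealizer
          ((left_scalars_twistedPairs (frob K L ^ h) hη).ge (show _ = _ by rw [hτ]; rfl))
      omega
    have hτk : frob K L ^ h ≠ (frob K L ^ t) ^ k := by
      intro hτ
      have hle := card_le_ncard_of_scalar_mem (K := K) (L := L)
        (S := rightIdealizer (windowCode (frob K L ^ t) k (twistedPairs (frob K L ^ h) η)))
        fun c => scalar_mem_rightIdealizer
          ((right_scalars_twistedPairs (frob K L ^ h) ((frob K L ^ t) ^ k) hη).ge
            (show _ = _ by rw [hτ, inv_mul_cancel]; rfl))
      omega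
    rw [ncard_leftIdealizer_windowCode (exists_pow_frob_pow_eq ht') hk hkt hmt
      (transversal_twistedPairs hτk hη), left_scalars_twistedPairs _ hη] at hl
    rw [ncard_rightIdealizer_windowCode (exists_pow_frob_pow_eq ht') hk hkt hmt
      (transversal_twistedPairs hτ1 hη), right_scalars_twistedPairs _ _ hη] at hr
    have h1 := eq_frob_pow_of_orderOf_eq_two hL ((orderOf_eq_of_ncard_fixed_eq hl).trans hθ2)
    have h2 := eq_frob_pow_of_orderOf_eq_two hL ((orderOf_eq_of_ncard_fixed_eq hr).trans hθ2)
    -- From `τ = τ⁻¹ σ^k = frob ^ n` it follows that `σ^k` is the square of an involution.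
    rw [h1, inv_mul_eq_iff_eq_mul, ← pow_two] at h2
    have h3 := pow_orderOf_eq_one (frob K L ^ n)
    rw [hθ2] at h3
    exact pow_ne_one_of_lt_orderOf (by omega) hkt (h2.trans h3)
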